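/- Let $L\ge 1$ be an integer and let $0<p<1$, $0<q<1$. The finite-memory walk $(X_k)_{k\ge 0}$ is the nearest-neighbour process on $\mathbb Z$, with arbitrary (possibly random) starting point $X_0$, such that, conditionally on $X_0,\dots,X_k$, it steps from $X_k$ to $X_k+1$ with probability $p$ if $X_k=\max_{0\le m\le L\wedge k}X_{k-m}$, with probability $q$ if $X_k=\min_{0\le m\le L\wedge k}X_{k-m}$, with probability $\frac12$ if both or neither of these hold, and otherwise steps to $X_k-1$. Let $E=\{-1,+1\}^L$. Call $\eta=(\eta^1,\dots,\eta^L)\in E$ a local maximum if $\eta^1+\dots+\eta^j\ge 0$ for all $1\le j\le L$, and a local minimum if $\eta^1+\dots+\eta^j\le 0$ for all $1\le j\le L$. The history chain $(Y_k)$ on $E$ jumps from $\eta$ to $(s,\eta^1,\dots,\eta^{L-1})$, where $s=+1$ with probability $p$ if $\eta$ is a local maximum, $q$ if $\eta$ is a local minimum, $\frac12$ otherwise, and $s=-1$ with the complementary probability. For $k\ge L$ the history of the walk is $Y_k=(X_k-X_{k-1},\dots,X_{k-L+1}-X_{k-L})$. More generally, the finite-memory chain $(X_k,Y_k)_{k\ge0}$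 is the Markov chain on $\mathbb Z\times E$, with arbitrary law of $(X_0,Y_0)$, which jumps from $(x,\eta)$ to $(x+s,(s,\eta^1,\dots,\eta^{L-1}))$ with these probabilities. Theorem. The history chain has exactly one stationary distribution $\pi$. Put $$\Delta_L=(2p-1)\sum_{\eta\text{ local max.}}\pi(\eta)+(2q-1)\sum_{\eta\text{ local min.}}\pi(\eta),\qquad f(\eta)=\eta^1 .$$ Then the limit in $$\sigma^2=\mathrm{Var}_\pi(f(Y_1))+2\lim_{m\to\infty}\sum_{k=1}^{m+1}\mathrm{Cov}_\pi\bigl(f(Y_1),f(Y_{k+1})\bigr)$$ exists and is finite, where variance and covariances are those of the history chain in its stationary regime $\pi$; moreover $\sigma^2\ge 0$, and $$\frac{X_n-n\Delta_L}{\sqrt n}\Longrightarrow\mathcal N(0,\sigma^2)\qquad(n\to\infty)$$ in distribution, both for the finite-memory walk $(X_n)$ and for the first component of the finite-memory chain. (If $\sigma^2=0$, $\mathcal N(0,\sigma^2)$ means the point mass at $0$.) -/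

import Mathlib

open MeasureTheory ProbabilityTheory Filter Topology

noncomputable section

namespace Snake

/-! ### The walk perturbed at its extrema over a finite memory -/

/-- `x k` is the maximum of `x (k - m)`, `m = 0, 1, …, min L k`. -/
def AtMax (L : ℕ) (x : ℕ → ℤ) (k : ℕ) : Prop :=
  ∀ m ≤ min L k, x (k - m) ≤ x k

/-- `x k` is the minimum of `x (k - m)`, `m = 0, 1, …, min L k`. -/
def AtMin (L : ℕ) (x : ℕ → ℤ) (k : ℕ) : Prop :=
  ∀ m ≤ min L k, x k ≤ x (k - m)

open Classical in
/-- Probability that the walk, having followed the path `x` up to time `k`, steps to `x k + 1`. -/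
def walkUp (L : ℕ) (p q : ℝ) (x : ℕ → ℤ) (k : ℕ) : ℝ :=
  if AtMax L x k ∧ AtMin L x k then 1 / 2
  else if AtMax L x k then p
  else if AtMin L x k then q
  else 1 / 2

/-- `X` is a realization, on the probability space `(Ω, μ)`, of the nearest-neighbour walk on `ℤ`
perturbed at its extrema over the last `L` steps, with an arbitrary (possibly random) start. The
conditional probabilities given the past are spelled out on the atoms `X 0 = x 0, …, X k = x k`
of the past. -/
structure IsFiniteMemoryWalk {Ω : Type*} [MeasurableSpace Ω] (L : ℕ) (p q : ℝ)
    (μ : Measure Ω) (X : ℕ → Ω → ℤ) : Prop where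
  measurable : ∀ k, Measurable (X k)
  up : ∀ (k : ℕ) (x : ℕ → ℤ),
    μ.real {ω | (∀ i ≤ k, X i ω = x i) ∧ X (k + 1) ω = x k + 1} =
      walkUp L p q x k * μ.real {ω | ∀ i ≤ k, X i ω = x i}
  down : ∀ (k : ℕ) (x : ℕ → ℤ),
    μ.real {ω | (∀ i ≤ k, X i ω = x i) ∧ X (k + 1) ω = x k - 1} =
      (1 - walkUp L p q x k) * μ.real {ω | ∀ i ≤ k, X i ω = x i}

/-! ### The chain of the last `L` steps -/

/-- Sequences of `L` signs `-1, +1` (the units of `ℤ`); index `0` is the most recent step. -/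
abbrev Hist (L : ℕ) : Type := Fin L → ℤˣ

namespace Hist

/-- All partial sums `η 0 + ⋯ + η j` are nonnegative. -/
def LocMax {L : ℕ} (η : Hist L) : Prop :=
  ∀ j : Fin L, 0 ≤ ∑ i ∈ Finset.Iic j, (η i : ℤ)

/-- All partial sums `η 0 + ⋯ + η j` are nonpositive. -/
def LocMin {L : ℕ} (η : Hist L) : Prop :=
  ∀ j : Fin L, ∑ i ∈ Finset.Iic j, (η i : ℤ) ≤ 0

/-- Put the new step `s` in front and forget the oldest one. -/
def push {L : ℕ} (s : ℤˣ) (η : Hist L) : Hist L := fun i =>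
  if (i : ℕ) = 0 then s else η ⟨(i : ℕ) - 1, by omega⟩

end Hist

open Classical in
/-- Probability that the step following the history `η` is `+1`. (For `L ≥ 1` no history is both
a local maximum and a local minimum.) -/
def histUp {L : ℕ} (p q : ℝ) (η : Hist L) : ℝ :=
  if η.LocMax then p else if η.LocMin then q else 1 / 2

/-- Probability that the step following the history `η` is `s`. -/
def stepProb {L : ℕ} (p q : ℝ) (η : Hist L) (s : ℤˣ) : ℝ :=
  if s = 1 then histUp p q η else 1 - histUp p q η

/-- Transition matrix of the chain of histories. -/
def transition (L : ℕ) (p q : ℝ) : Matrix (Hist L) (Hist L) ℝ := fun η η' =>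
  ∑ s : ℤˣ, if η' = Hist.push s η then stepProb p q η s else 0

/-- `(X, Y)` is a realization, on the probability space `(Ω, μ)`, of the Markov chain of positions
and histories: from `(x, η)` it jumps to `(x + s, push s η)` with probability `stepProb p q η s`.
The law of `(X 0, Y 0)` is arbitrary. -/
structure IsFiniteMemoryChain {Ω : Type*} [MeasurableSpace Ω] (L : ℕ) (p q : ℝ)
    (μ : Measure Ω) (X : ℕ → Ω → ℤ) (Y : ℕ → Ω → Hist L) : Prop where
  measurable_pos : ∀ k, Measurable (X k)
  measurable_hist : ∀ k (η : Hist L), MeasurableSet {ω | Y k ω = η}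
  step : ∀ (k : ℕ) (x : ℕ → ℤ) (y : ℕ → Hist L) (s : ℤˣ),
    μ.real {ω | (∀ i ≤ k, X i ω = x i ∧ Y i ω = y i) ∧
        X (k + 1) ω = x k + (s : ℤ) ∧ Y (k + 1) ω = Hist.push s (y k)} =
      stepProb p q (y k) s * μ.real {ω | ∀ i ≤ k, X i ω = x i ∧ Y i ω = y i}

/-! ### Stationary quantities -/

/-- `π` is a stationary probability vector of the chain of histories. -/
structure IsStationary (L : ℕ) (p q : ℝ) (π : Hist L → ℝ) : Prop where
  nonneg : ∀ η, 0 ≤ π η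
  sum_eq_one : ∑ η, π η = 1
  invariant : ∀ η', ∑ η, π η * transition L p q η η' = π η'

open Classical in
/-- The speed `(2p - 1) π(max) + (2q - 1) π(min)`. -/
def speed (L : ℕ) (p q : ℝ) (π : Hist L → ℝ) : ℝ :=
  (2 * p - 1) * (∑ η with Hist.LocMax η, π η) + (2 * q - 1) * (∑ η with Hist.LocMin η, π η)

/-- The most recent step of a history, as a real number. -/
def lastStep {L : ℕ} [NeZero L] (η : Hist L) : ℝ := ((η 0 : ℤ) : ℝ)

/-- Mean of the most recent step under `π`. -/
def meanStep {L : ℕ} [NeZero L] (π : Hist L → ℝ) : ℝ := ∑ η, π η * lastStep η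

/-- Variance of the most recent step under `π`. -/
def varStep {L : ℕ} [NeZero L] (π : Hist L → ℝ) : ℝ :=
  ∑ η, π η * (lastStep η - meanStep π) ^ 2

/-- Covariance of `lastStep (Y 1)` and `lastStep (Y (k + 1))` for the chain of histories `Y`
started from its stationary vector `π`: the pair `(Y 1, Y (k + 1))` takes the value `(η, η')` with
probability `π η * (transition L p q ^ k) η η'`. -/
def autocov (L : ℕ) [NeZero L] (p q : ℝ) (π : Hist L → ℝ) (k : ℕ) : ℝ :=
  ∑ η, ∑ η', π η * (transition L p q ^ k) η η' *
    ((lastStep η - meanStep π) * (lastStep η' - meanStep π))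

end Snake

end

/-! The proof is a martingale central limit theorem by correctors and characteristic functions. Any
history can be overwritten in `L` steps, so the `L`-th power of the transition matrix `P` is
positive; hence `P ^ k` converges geometrically to a unique stationary `π`, and the Poisson equation
`G - P G = f` is solvable for every `f` centred under `π`.

Take `f` to be the last step minus its mean `Δ`, and set `g = P G`. Then `X k - k Δ + g (Y k)` has
conditionally centred increments, whose conditional variance `v` satisfies `π ⬝ᵥ v = σ²`; this
identifies the covariance series and shows `σ² ≥ 0`. A second Poisson equation, for `v - σ²`, yields
`w` such that the expectation of `exp (iθ (X k - k Δ + g (Y k))) (1 + θ² w (Y k))` is multiplied at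
each step by `1 - θ² σ² / 2`, up to `O(|θ|³)` (`exists_norm_sum_exp_corrIncr_le`). With `θ` of order
`n ^ (-1/2)`, the errors of `n` steps vanish, the product tends to `exp (-σ² t² / 2)`, and `g`, `w`
disappear in the limit.

Walk and chain both enter through `EvolvesFrom`, from time `L` and from time `0` respectively. -/

namespace Snake

open Matrix

/-! ### Primitive stochastic matrices: geometric ergodicity and the Poisson equation. -/

section RowStochastic

variable {ι : Type*} [Fintype ι] [DecidableEq ι] {P : Matrix ι ι ℝ}

/-- A row stochastic matrix whose entries are at least `δ` contracts oscillations. -/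
lemma mulVec_sub_mulVec_le (hP : P ∈ rowStochastic ℝ ι) {δ c : ℝ} (hδ : ∀ i j, δ ≤ P i j)
    {f : ι → ℝ} (hf : ∀ i j, f i - f j ≤ c) (a b : ι) :
    (P *ᵥ f) a - (P *ᵥ f) b ≤ (1 - Fintype.card ι * δ) * c := by
  have : Nonempty ι := ⟨a⟩
  obtain ⟨z, hz⟩ := Finite.exists_min f
  have hrow := sum_row_of_mem_rowStochastic hP
  -- Doeblin's splitting: the part `δ` common to all entries contributes the same amount to every
  -- row and cancels in differences; the remaining weights `P i j - δ` are nonnegative with sum `1 -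
  -- card ι * δ`.
  have key (i : ι) : (P *ᵥ f) i =
      ∑ j, (P i j - δ) * (f j - f z) + δ * ∑ j, (f j - f z) + f z := by
    have h1 : ∑ j, P i j * f z = f z := by rw [← Finset.sum_mul, hrow, one_mul]
    simp only [mulVec, dotProduct, Finset.mul_sum, ← Finset.sum_add_distrib]
    nth_rewrite 3 [← h1]
    rw [← Finset.sum_add_distrib]
    exact Finset.sum_congr rfl fun j _ ↦ by ring
  have h1 : ∑ j, (P a j - δ) * (f j - f z) ≤ ∑ j, (P a j - δ) * c :=
    Finset.sum_le_sum fun j _ ↦ mul_le_mul_of_nonneg_left (hf j z) (sub_nonneg.2 (hδ a j))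
  have h2 : 0 ≤ ∑ j, (P b j - δ) * (f j - f z) :=
    Finset.sum_nonneg fun j _ ↦ mul_nonneg (sub_nonneg.2 (hδ b j)) (sub_nonneg.2 (hz j))
  rw [← Finset.sum_mul, Finset.sum_sub_distrib, hrow] at h1
  simp only [Finset.sum_const, Finset.card_univ, nsmul_eq_mul] at h1
  rw [key a, key b]
  linarith

lemma pow_mulVec_sub_le (hP : P ∈ rowStochastic ℝ ι) {δ c : ℝ} (hδ : ∀ i j, δ ≤ P i j)
    {f : ι → ℝ} (hf : ∀ i j, f i - f j ≤ c) (k : ℕ) (a b : ι) :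
    (P ^ k *ᵥ f) a - (P ^ k *ᵥ f) b ≤ (1 - Fintype.card ι * δ) ^ k * c := by
  induction k generalizing a b with
  | zero => simpa using hf a b
  | succ k ih =>
    rw [pow_succ', ← mulVec_mulVec, pow_succ', mul_assoc]
    exact mulVec_sub_mulVec_le hP hδ ih a b

/-- Powers of a primitive stochastic matrix contract oscillations geometrically. -/
lemma exists_geometric_contraction [Nonempty ι] (hP : P ∈ rowStochastic ℝ ι) {n : ℕ} (hn : n ≠ 0)
    (hpos : ∀ i j, 0 < (P ^ n) i j) :
    ∃ C r : ℝ, 0 ≤ C ∧ 0 ≤ r ∧ r < 1 ∧ ∀ (f : ι → ℝ) (c : ℝ), (∀ i j, f i - f j ≤ c) →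
      ∀ k a b, (P ^ k *ᵥ f) a - (P ^ k *ᵥ f) b ≤ C * r ^ k * c := by
  obtain ⟨z, hz⟩ := Finite.exists_min fun x : ι × ι ↦ (P ^ n) x.1 x.2
  set δ : ℝ := (P ^ n) z.1 z.2 with hδdef
  have hδ : 0 < δ := hpos _ _
  have hmin : ∀ i j, δ ≤ (P ^ n) i j := fun i j ↦ hz (i, j)
  have hPn : P ^ n ∈ rowStochastic ℝ ι := pow_mem hP n
  set N : ℝ := (Fintype.card ι : ℝ) with hN
  have hNpos : 0 < N := by rw [hN]; exact_mod_cast Fintype.card_pos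
  have hNδ : N * δ ≤ 1 := by
    rw [← sum_row_of_mem_rowStochastic hPn z.1]
    calc N * δ = ∑ _j : ι, δ := by simp [hN]
      _ ≤ _ := Finset.sum_le_sum fun j _ ↦ hmin _ _
  have hNδ0 : 0 < N * δ := mul_pos hNpos hδ
  have hn1 : (1 : ℝ) ≤ n := by exact_mod_cast Nat.one_le_iff_ne_zero.2 hn
  -- Bernoulli gives `(1 - x) ^ n ≥ 1 - n x = 1 - N δ / 2`. The factor `2` keeps `1 - x` positive
  -- even when `N δ = 1`, so that it can be inverted below.
  set x : ℝ := N * δ / (2 * n) with hx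
  have hx0 : 0 < x := by positivity
  have hx1 : x ≤ 1 / 2 := by
    rw [hx, div_le_iff₀ (by positivity)]; linarith
  have hr0 : 0 < 1 - x := by linarith
  have hbern : 1 - N * δ ≤ (1 - x) ^ n := by
    have h := one_add_mul_le_pow (a := -x) (by linarith) n
    have h2 : (n : ℝ) * x = N * δ / 2 := by rw [hx]; field_simp
    calc 1 - N * δ ≤ 1 + n * -x := by linarith
      _ ≤ _ := by rw [sub_eq_add_neg]; exact h
  -- Only the `k / n` full blocks contract; the constant pays for the `k % n < n` leftover steps.
  refine ⟨((1 - x) ^ n)⁻¹, 1 - x, by positivity, hr0.le, by linarith, fun f c hf k a b ↦ ?_⟩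
  have hc : 0 ≤ c := by simpa using hf a a
  have hmain : ∀ a b, (P ^ (n * (k / n)) *ᵥ f) a - (P ^ (n * (k / n)) *ᵥ f) b
      ≤ (1 - x) ^ (n * (k / n)) * c := fun a b ↦ by
    rw [pow_mul, pow_mul]
    exact (pow_mulVec_sub_le hPn hmin hf _ a b).trans
      (mul_le_mul_of_nonneg_right (pow_le_pow_left₀ (by linarith) hbern _) hc)
  -- With `δ = 0` the one-step bound says that the leftover steps do not increase the oscillation.
  have hrest := mulVec_sub_mulVec_le (pow_mem hP (k % n)) (δ := 0)
    (fun i j ↦ nonneg_of_mem_rowStochastic (pow_mem hP (k % n))) hmain a b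
  rw [mulVec_mulVec, ← pow_add, Nat.mod_add_div] at hrest
  refine hrest.trans ?_
  rw [mul_zero, sub_zero, one_mul]
  refine mul_le_mul_of_nonneg_right ?_ hc
  rw [inv_mul_eq_div, le_div_iff₀ (by positivity), ← pow_add]
  refine pow_le_pow_of_le_one hr0.le (by linarith) ?_
  have := Nat.mod_add_div k n
  have := Nat.mod_lt k (Nat.pos_of_ne_zero hn)
  omega

lemma vecMul_pow_of_vecMul {π : ι → ℝ} (hinv : π ᵥ* P = π) (k : ℕ) : π ᵥ* P ^ k = π := by
  induction k with
  | zero => simp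
  | succ k ih => rw [pow_succ, ← vecMul_vecMul, ih, hinv]

/-- Powers of a primitive stochastic matrix converge geometrically to a stationary vector. -/
lemma exists_stationary_of_primitive [Nonempty ι] (hP : P ∈ rowStochastic ℝ ι) {n : ℕ} (hn : n ≠ 0)
    (hpos : ∀ i j, 0 < (P ^ n) i j) :
    ∃ (π : ι → ℝ) (C r : ℝ), (∀ i, 0 ≤ π i) ∧ ∑ i, π i = 1 ∧ π ᵥ* P = π ∧ 0 ≤ r ∧ r < 1 ∧
      ∀ k i j, |(P ^ k) i j - π j| ≤ C * r ^ k := by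
  obtain ⟨C, r, hC, hr, hr1, hosc⟩ := exists_geometric_contraction hP hn hpos
  have hrow k := sum_row_of_mem_rowStochastic (pow_mem hP k)
  have hnn k {i j} : 0 ≤ (P ^ k) i j := nonneg_of_mem_rowStochastic (pow_mem hP k)
  have hcol (k : ℕ) (j a b : ι) : (P ^ k) a j - (P ^ k) b j ≤ C * r ^ k := by
    have h := hosc (Pi.single j 1) 1 (fun i i' ↦ ?_) k a b
    · simpa using h
    · simp only [Pi.single_apply]; split_ifs <;> norm_num
  have hcol' (k : ℕ) (j a b : ι) : |(P ^ k) a j - (P ^ k) b j| ≤ C * r ^ k :=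
    abs_le.2 ⟨by linarith [hcol k j b a], hcol k j a b⟩
  have havg (k : ℕ) (j b : ι) (ν : ι → ℝ) (hν : ∀ i, 0 ≤ ν i) (hν1 : ∑ i, ν i = 1) :
      |∑ i, ν i * (P ^ k) i j - (P ^ k) b j| ≤ C * r ^ k := by
    have : (P ^ k) b j = ∑ i, ν i * (P ^ k) b j := by rw [← Finset.sum_mul, hν1, one_mul]
    rw [this, ← Finset.sum_sub_distrib]
    calc |∑ i, (ν i * (P ^ k) i j - ν i * (P ^ k) b j)|
        ≤ ∑ i, |ν i * (P ^ k) i j - ν i * (P ^ k) b j| := Finset.abs_sum_le_sum_abs _ _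
      _ ≤ ∑ i, ν i * (C * r ^ k) := Finset.sum_le_sum fun i _ ↦ by
          rw [← mul_sub, abs_mul, abs_of_nonneg (hν i)]
          exact mul_le_mul_of_nonneg_left (hcol' k j i b) (hν i)
      _ = _ := by rw [← Finset.sum_mul, hν1, one_mul]
  -- Entry `(i, j)` of `P ^ (k + 1)` is an average of column `j` of `P ^ k`, hence differs from any
  -- entry of it by at most its oscillation.
  have hcauchy (i j : ι) : CauchySeq fun k ↦ (P ^ k) i j := by
    refine cauchySeq_of_le_geometric r C hr1 fun k ↦ ?_
    rw [dist_comm, Real.dist_eq, pow_succ', mul_apply]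
    exact havg k j i (P i) (fun _ ↦ nonneg_of_mem_rowStochastic hP)
      (sum_row_of_mem_rowStochastic hP i)
  obtain ⟨z⟩ := ‹Nonempty ι›
  choose π hπ using fun j ↦ cauchySeq_tendsto_of_complete (hcauchy z j)
  have hπ0 : ∀ i, 0 ≤ π i := fun i ↦ ge_of_tendsto' (hπ i) fun k ↦ hnn k
  have hπ1 : ∑ i, π i = 1 :=
    tendsto_nhds_unique (tendsto_finsetSum _ fun i _ ↦ hπ i) (by simp [hrow])
  have hinv : π ᵥ* P = π := by
    ext j
    refine tendsto_nhds_unique (f := fun k ↦ (P ^ (k + 1)) z j) ?_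
      ((tendsto_add_atTop_iff_nat 1).2 (hπ j))
    simp only [pow_succ, mul_apply, vecMul, dotProduct]
    exact tendsto_finsetSum _ fun i _ ↦ (hπ i).mul_const _
  refine ⟨π, C, r, hπ0, hπ1, hinv, hr, hr1, fun k i j ↦ ?_⟩
  rw [abs_sub_comm]
  nth_rewrite 1 [← vecMul_pow_of_vecMul hinv k]
  exact havg k j i π hπ0 hπ1

/-- `π'` equals `π' ᵥ* P ^ k` for all `k`, and every row of `P ^ k` tends to `π`. -/
lemma eq_of_stationary {π π' : ι → ℝ} {C r : ℝ} (hr : 0 ≤ r) (hr1 : r < 1)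
    (hgeo : ∀ k i j, |(P ^ k) i j - π j| ≤ C * r ^ k)
    (hsum : ∑ i, π' i = 1) (hinv : π' ᵥ* P = π') : π' = π := by
  ext j
  have hlim (i : ι) : Tendsto (fun k ↦ (P ^ k) i j) atTop (𝓝 (π j)) := by
    rw [tendsto_iff_dist_tendsto_zero]
    refine squeeze_zero (fun _ ↦ dist_nonneg) (fun k ↦ hgeo k i j) ?_
    simpa using (tendsto_pow_atTop_nhds_zero_of_lt_one hr hr1).const_mul C
  have h1 : Tendsto (fun k ↦ ∑ i, π' i * (P ^ k) i j) atTop (𝓝 (∑ i, π' i * π j)) :=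
    tendsto_finsetSum _ fun i _ ↦ (hlim i).const_mul _
  rw [← Finset.sum_mul, hsum, one_mul] at h1
  refine tendsto_nhds_unique (h1.congr fun k ↦ ?_) tendsto_const_nhds |>.symm
  exact congrFun (vecMul_pow_of_vecMul hinv k) j

/-- The potential `∑ P ^ k f` of a centered function converges and solves the Poisson equation. -/
lemma exists_poisson {π : ι → ℝ} {C r : ℝ} (hr : 0 ≤ r) (hr1 : r < 1)
    (hgeo : ∀ k i j, |(P ^ k) i j - π j| ≤ C * r ^ k) {f : ι → ℝ} (hf : π ⬝ᵥ f = 0) :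
    ∃ G : ι → ℝ, (∀ i, HasSum (fun k ↦ (P ^ k *ᵥ f) i) (G i)) ∧ G - P *ᵥ G = f := by
  have hsummable (i : ι) : Summable fun k ↦ (P ^ k *ᵥ f) i := by
    refine Summable.of_norm_bounded (g := fun k ↦ (C * ∑ j, |f j|) * r ^ k)
      ((summable_geometric_of_lt_one hr hr1).mul_left _) fun k ↦ ?_
    -- Since `f` is centred, subtracting `π j` from the entries changes nothing and exposes the
    -- geometric decay.
    have : (P ^ k *ᵥ f) i = ∑ j, ((P ^ k) i j - π j) * f j := by
      simp only [sub_mul, Finset.sum_sub_distrib]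
      change _ = _ - π ⬝ᵥ f
      rw [hf, sub_zero]; rfl
    rw [this, Real.norm_eq_abs]
    calc |∑ j, ((P ^ k) i j - π j) * f j| ≤ ∑ j, |((P ^ k) i j - π j) * f j| :=
          Finset.abs_sum_le_sum_abs _ _
      _ ≤ ∑ j, (C * r ^ k) * |f j| := Finset.sum_le_sum fun j _ ↦ by
          rw [abs_mul]; exact mul_le_mul_of_nonneg_right (hgeo k i j) (abs_nonneg _)
      _ = _ := by rw [← Finset.mul_sum]; ring
  refine ⟨fun i ↦ ∑' k, (P ^ k *ᵥ f) i, fun i ↦ (hsummable i).hasSum, ?_⟩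
  ext i
  have h1 : HasSum (fun k ↦ (P ^ (k + 1) *ᵥ f) i) ((P *ᵥ fun i ↦ ∑' k, (P ^ k *ᵥ f) i) i) := by
    have : (fun k ↦ (P ^ (k + 1) *ᵥ f) i) = fun k ↦ ∑ j, P i j * (P ^ k *ᵥ f) j := by
      ext k; rw [pow_succ', ← mulVec_mulVec]; rfl
    rw [this]
    exact hasSum_sum fun j _ ↦ (hsummable j).hasSum.mul_left _
  have h2 := (hsummable i).tsum_eq_zero_add
  rw [h1.tsum_eq] at h2
  simp only [pow_zero, one_mulVec] at h2
  simp [h2]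

end RowStochastic

/-! ### The chain of histories: primitivity, speed and correctors. -/

section Transition

variable {L : ℕ} {p q : ℝ}

lemma sum_sign {M : Type*} [AddCommMonoid M] (F : ℤˣ → M) : ∑ s, F s = F 1 + F (-1) := by
  rw [show (Finset.univ : Finset ℤˣ) = {1, -1} from rfl, Finset.sum_pair (by decide)]

lemma stepProb_one (η : Hist L) : stepProb p q η 1 = histUp p q η := by simp [stepProb]

lemma stepProb_neg_one (η : Hist L) : stepProb p q η (-1) = 1 - histUp p q η := by
  have : (-1 : ℤˣ) ≠ 1 := by decide
  simp [stepProb, this]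

lemma sum_stepProb (η : Hist L) : ∑ s, stepProb p q η s = 1 := by
  rw [sum_sign, stepProb_one, stepProb_neg_one]; ring

lemma stepProb_pos (hp : 0 < p) (hp1 : p < 1) (hq : 0 < q) (hq1 : q < 1) (η : Hist L) (s : ℤˣ) :
    0 < stepProb p q η s := by
  have h : 0 < histUp p q η ∧ histUp p q η < 1 := by
    unfold histUp; split_ifs <;> constructor <;> linarith
  unfold stepProb; split_ifs <;> linarith

lemma transition_mulVec (f : Hist L → ℝ) (η : Hist L) :
    (transition L p q *ᵥ f) η = ∑ s, stepProb p q η s * f (Hist.push s η) := by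
  simp only [mulVec, dotProduct, transition, Finset.sum_mul, ite_mul, zero_mul]
  rw [Finset.sum_comm]
  simp

lemma transition_mem_rowStochastic (hp : 0 < p) (hp1 : p < 1) (hq : 0 < q) (hq1 : q < 1) :
    transition L p q ∈ rowStochastic ℝ (Hist L) := by
  rw [mem_rowStochastic]
  refine ⟨fun η η' ↦ Finset.sum_nonneg fun s _ ↦ ?_, ?_⟩
  · split_ifs
    · exact (stepProb_pos hp hp1 hq hq1 η s).le
    · exact le_rfl
  · ext η
    simp only [transition_mulVec, Pi.one_apply, mul_one, sum_stepProb]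

lemma transition_push_pos (hp : 0 < p) (hp1 : p < 1) (hq : 0 < q) (hq1 : q < 1)
    (η : Hist L) (s : ℤˣ) : 0 < transition L p q η (Hist.push s η) := by
  refine Finset.sum_pos' (fun s' _ ↦ ?_) ⟨s, Finset.mem_univ _, ?_⟩
  · split_ifs
    · exact (stepProb_pos hp hp1 hq hq1 η s').le
    · exact le_rfl
  · simpa using stepProb_pos hp hp1 hq hq1 η s

/-- Push the signs of `ξ`, oldest first: after `j` pushes the `j` most recent entries are the last
`j` entries of `ξ`, and after `L` pushes nothing of `η` is left. -/
lemma transition_pow_pos (hp : 0 < p) (hp1 : p < 1) (hq : 0 < q) (hq1 : q < 1)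
    (η ξ : Hist L) : 0 < (transition L p q ^ L) η ξ := by
  have key : ∀ j ≤ L, ∃ y : Hist L, 0 < (transition L p q ^ j) η y ∧
      ∀ i : Fin L, (hi : (i : ℕ) < j) → y i = ξ ⟨i + L - j, by omega⟩ := by
    intro j
    induction j with
    | zero => exact fun _ ↦ ⟨η, by simp, fun i hi ↦ absurd hi (by omega)⟩
    | succ j ih =>
      intro hj
      obtain ⟨y, hy, hyξ⟩ := ih (by omega)
      refine ⟨Hist.push (ξ ⟨L - (j + 1), by omega⟩) y, ?_, fun i hi ↦ ?_⟩
      · rw [pow_succ, mul_apply]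
        have hP := transition_mem_rowStochastic (L := L) hp hp1 hq hq1
        exact Finset.sum_pos' (fun z _ ↦ mul_nonneg
            (nonneg_of_mem_rowStochastic (pow_mem hP j)) (nonneg_of_mem_rowStochastic hP))
          ⟨y, Finset.mem_univ _, mul_pos hy (transition_push_pos hp hp1 hq hq1 _ _)⟩
      · unfold Hist.push
        split_ifs with h0
        · simp [h0]
        · rw [hyξ _ (by simp only; omega)]
          congr 2
          simp only
          omega
  obtain ⟨y, hy, hyξ⟩ := key L le_rfl
  have : y = ξ := by
    ext i
    rw [hyξ i i.2]
    simp
  rwa [← this]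

lemma lastStep_push [NeZero L] (s : ℤˣ) (η : Hist L) :
    lastStep (Hist.push s η) = ((s : ℤ) : ℝ) := by
  simp [lastStep, Hist.push]

lemma Hist.apply_zero_of_locMax [NeZero L] {η : Hist L} (h : η.LocMax) : η 0 = 1 := by
  have h0 := h 0
  have : Finset.Iic (0 : Fin L) = {0} := by ext i; simp
  rw [this, Finset.sum_singleton] at h0
  rcases Int.units_eq_one_or (η 0) with h1 | h1
  · exact h1
  · simp [h1] at h0

lemma Hist.apply_zero_of_locMin [NeZero L] {η : Hist L} (h : η.LocMin) : η 0 = -1 := by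
  have h0 := h 0
  have : Finset.Iic (0 : Fin L) = {0} := by ext i; simp
  rw [this, Finset.sum_singleton] at h0
  rcases Int.units_eq_one_or (η 0) with h1 | h1
  · simp [h1] at h0
  · exact h1

lemma Hist.not_locMin_of_locMax [NeZero L] {η : Hist L} (h : η.LocMax) : ¬ η.LocMin := fun h' ↦
  absurd ((Hist.apply_zero_of_locMax h).symm.trans (Hist.apply_zero_of_locMin h')) (by decide)

/-- By invariance the last step and the next step have the same mean, and the next step has
conditional mean `2p - 1`, `2q - 1` or `0`. The first two cases exclude each other, because they
force opposite signs of the last step. -/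
lemma speed_eq_meanStep [NeZero L] {π : Hist L → ℝ} (hπ : IsStationary L p q π) :
    speed L p q π = meanStep π := by
  classical
  have h1 : meanStep π = ∑ η, π η * (transition L p q *ᵥ lastStep) η := by
    have hinv : π ᵥ* transition L p q = π := funext hπ.invariant
    change π ⬝ᵥ lastStep = π ⬝ᵥ (transition L p q *ᵥ lastStep)
    rw [dotProduct_mulVec, hinv]
  rw [h1, speed, Finset.sum_filter, Finset.sum_filter, Finset.mul_sum, Finset.mul_sum,
    ← Finset.sum_add_distrib]
  refine Finset.sum_congr rfl fun η _ ↦ ?_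
  rw [transition_mulVec, sum_sign, stepProb_one, stepProb_neg_one, lastStep_push, lastStep_push]
  unfold histUp
  by_cases hM : η.LocMax
  · simp [hM, Hist.not_locMin_of_locMax hM]; ring
  · by_cases hm : η.LocMin
    · simp [hM, hm]; ring
    · simp [hM, hm]; norm_num

/-- The increment, along a step `s` from the history `η`, of the position compensated by the
drift `Δ` and the corrector `g`. -/
def corrIncr (Δ : ℝ) (g : Hist L → ℝ) (η : Hist L) (s : ℤˣ) : ℝ :=
  ((s : ℤ) : ℝ) - Δ + g (Hist.push s η) - g η

/-- The correctors are `g = P G` and `w = -W / 2`, where `G` and `W` solve the Poisson equations of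
the centred step and of the centred conditional variance. The two final identities cancel the first-
and second-order terms in the expansion of the characteristic function. -/
theorem exists_stationary_and_correctors [NeZero L]
    (hp : 0 < p) (hp1 : p < 1) (hq : 0 < q) (hq1 : q < 1) :
    ∃ π : Hist L → ℝ, IsStationary L p q π ∧ (∀ π', IsStationary L p q π' → π' = π) ∧
      ∃ (c : ℝ) (σsq : NNReal),
        Tendsto (fun m : ℕ ↦ ∑ k ∈ Finset.Icc 1 (m + 1), autocov L p q π k) atTop (𝓝 c) ∧
        (σsq : ℝ) = varStep π + 2 * c ∧
        ∃ g w : Hist L → ℝ,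
          (∀ η, ∑ s, stepProb p q η s * corrIncr (speed L p q π) g η s = 0) ∧
          ∀ η, ∑ s, stepProb p q η s *
            (w (Hist.push s η) - corrIncr (speed L p q π) g η s ^ 2 / 2) = w η - σsq / 2 := by
  have hP := transition_mem_rowStochastic (L := L) hp hp1 hq hq1
  obtain ⟨π, C, r, hπ0, hπ1, hinv, hr, hr1, hgeo⟩ :=
    exists_stationary_of_primitive hP (NeZero.ne L) (transition_pow_pos hp hp1 hq hq1)
  have hπ : IsStationary L p q π := ⟨hπ0, hπ1, fun η ↦ congrFun hinv η⟩
  refine ⟨π, hπ, fun π' h' ↦ eq_of_stationary hr hr1 hgeo h'.sum_eq_one (funext h'.invariant), ?_⟩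
  set P := transition L p q with hPdef
  set f : Hist L → ℝ := fun η ↦ lastStep η - meanStep π with hf
  have hcenter (F : Hist L → ℝ) : π ⬝ᵥ (P *ᵥ F) = π ⬝ᵥ F := by rw [dotProduct_mulVec, hinv]
  have hconst (a : ℝ) : π ⬝ᵥ (fun _ ↦ a) = a := by
    simp [dotProduct, ← Finset.sum_mul, hπ1]
  have hπf : π ⬝ᵥ f = 0 := by
    have : f = lastStep - fun _ ↦ meanStep π := rfl
    rw [this, dotProduct_sub, hconst]
    exact sub_self _
  obtain ⟨G, hG, hGf⟩ := exists_poisson hr hr1 hgeo hπf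
  have hPG : P *ᵥ G = G - f := by rw [← hGf]; abel
  -- `v` is the conditional variance of the martingale increment `G (push s η) - (P G) η`; its mean
  -- under `π` will be `σ²`, whence nonnegativity.
  set v : Hist L → ℝ := fun η ↦ ∑ s, stepProb p q η s * (G (Hist.push s η) - (P *ᵥ G) η) ^ 2
    with hv
  have hv0 : 0 ≤ π ⬝ᵥ v := Finset.sum_nonneg fun η _ ↦ mul_nonneg (hπ0 η) <|
    Finset.sum_nonneg fun s _ ↦ mul_nonneg (stepProb_pos hp hp1 hq hq1 η s).le (sq_nonneg _)
  have hv' : v = P *ᵥ (G ^ 2) - (P *ᵥ G) ^ 2 := by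
    ext η
    have h1 := transition_mulVec (p := p) (q := q) (G ^ 2) η
    have h2 := transition_mulVec (p := p) (q := q) G η
    have h3 := sum_stepProb (p := p) (q := q) η
    rw [sum_sign] at h1 h2 h3
    simp only [hv, Pi.sub_apply, Pi.pow_apply, sum_sign] at h1 ⊢
    rw [← hPdef] at h1 h2
    rw [h1]
    linear_combination (-2 * (P *ᵥ G) η) * (-h2) + (P *ᵥ G) η ^ 2 * h3
  have hcov (k : ℕ) : autocov L p q π k = π ⬝ᵥ fun η ↦ f η * (P ^ k *ᵥ f) η := by
    simp only [autocov, dotProduct, mulVec, Finset.mul_sum]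
    refine Finset.sum_congr rfl fun η _ ↦ Finset.sum_congr rfl fun η' _ ↦ ?_
    simp only [hf]; ring
  have hcovsum : HasSum (autocov L p q π) (π ⬝ᵥ (f * G)) := by
    have : autocov L p q π = fun k ↦ ∑ η, π η * (f η * (P ^ k *ᵥ f) η) := funext hcov
    rw [this]
    exact hasSum_sum fun η _ ↦ ((hG η).mul_left _).mul_left _
  have hvar : varStep π = π ⬝ᵥ (f ^ 2) := rfl
  have hcov0 : autocov L p q π 0 = varStep π := by
    rw [hcov, hvar, pow_zero, one_mulVec]
    congr 1; ext η; simp [sq]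
  -- Invariance turns `π ⬝ᵥ v` into the mean of `G² - (P G)² = G² - (G - f)²`. Here `π ⬝ᵥ (f * G)`
  -- sums the covariances from `k = 0`, and that first term is the variance.
  have hπv : π ⬝ᵥ v = varStep π + 2 * (π ⬝ᵥ (f * G) - varStep π) := by
    have : G ^ 2 - (G - f) ^ 2 = (2 : ℝ) • (f * G) - f ^ 2 := by
      ext η; simp; ring
    have h2 : π ⬝ᵥ v = π ⬝ᵥ (G ^ 2 - (G - f) ^ 2) := by
      rw [hv', dotProduct_sub, hcenter, ← dotProduct_sub, hPG]
    rw [h2, this, dotProduct_sub, dotProduct_smul, hvar, smul_eq_mul]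
    ring
  set u : Hist L → ℝ := fun η ↦ v η - π ⬝ᵥ v with hu
  have hπu : π ⬝ᵥ u = 0 := by
    have : u = v - fun _ ↦ π ⬝ᵥ v := rfl
    rw [this, dotProduct_sub, hconst, sub_self]
  obtain ⟨W, -, hW⟩ := exists_poisson hr hr1 hgeo hπu
  have hd (η : Hist L) (s : ℤˣ) :
      corrIncr (speed L p q π) (P *ᵥ G) η s = G (Hist.push s η) - (P *ᵥ G) η := by
    have := congrFun hGf (Hist.push s η)
    simp only [hf, Pi.sub_apply, lastStep_push] at this
    rw [corrIncr, speed_eq_meanStep hπ]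
    linarith
  obtain ⟨σsq, hσ⟩ : ∃ σsq : NNReal, (σsq : ℝ) = π ⬝ᵥ v := ⟨⟨_, hv0⟩, rfl⟩
  refine ⟨π ⬝ᵥ (f * G) - varStep π, σsq, ?_, hσ.trans hπv, P *ᵥ G, fun η ↦ -W η / 2,
    fun η ↦ ?_, fun η ↦ ?_⟩
  · have h := (((hasSum_nat_add_iff' 1).2 hcovsum).tendsto_sum_nat).comp (tendsto_add_atTop_nat 1)
    simp only [Finset.range_one, Finset.sum_singleton, hcov0] at h
    refine h.congr fun m ↦ ?_
    simp only [Function.comp]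
    rw [show Finset.Icc 1 (m + 1) = Finset.Ico (0 + 1) (m + 1 + 1) from rfl,
      ← Finset.sum_Ico_add', Finset.range_eq_Ico]
  · have h2 := transition_mulVec (p := p) (q := q) G η
    have h3 := sum_stepProb (p := p) (q := q) η
    simp only [hd, sum_sign] at h2 h3 ⊢
    rw [← hPdef] at h2
    linear_combination -h2 - (P *ᵥ G) η * h3
  · have h2 := transition_mulVec (p := p) (q := q) W η
    have h3 := congrFun hW η
    simp only [hd, hu, hv, Pi.sub_apply, sum_sign] at h2 h3 ⊢
    rw [← hPdef] at h2
    rw [hσ]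
    simp only [hv, sum_sign]
    linear_combination h2 / 2 + h3 / 2

end Transition

/-! ### Third-order expansion of one step of the corrected exponential. -/

section CharacteristicFunction

open Complex (I)

/-- Beyond the Taylor remainder of the exponential, the product leaves only terms in `θ³` and `θ⁴`,
and `θ⁴ ≤ |θ|³` because `|θ| ≤ 1`. -/
lemma norm_exp_mul_one_add_sub_le {θ d w D W : ℝ} (hθ : |θ| ≤ 1) (hd : |d| ≤ D) (hw : |w| ≤ W) :
    ‖Complex.exp ((θ * d : ℝ) * I) * (1 + θ ^ 2 * w) -
      (1 + θ * d * I + θ ^ 2 * (w - d ^ 2 / 2))‖ ≤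
      (D ^ 3 * Real.exp D * (1 + W) + (D + D ^ 2) * W) * |θ| ^ 3 := by
  have hD : 0 ≤ D := (abs_nonneg _).trans hd
  have hW : 0 ≤ W := (abs_nonneg _).trans hw
  have hθd : |θ * d| ≤ |θ| * D := by
    rw [abs_mul]; exact mul_le_mul_of_nonneg_left hd (abs_nonneg _)
  have hθd' : |θ * d| ≤ D := hθd.trans (mul_le_of_le_one_left hD hθ)
  set R : ℂ := Complex.exp ((θ * d : ℝ) * I) - (1 + θ * d * I - θ ^ 2 * d ^ 2 / 2) with hR
  have hRle : ‖R‖ ≤ |θ| ^ 3 * (D ^ 3 * Real.exp D) := by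
    have h := Complex.norm_exp_sub_sum_le_norm_mul_exp ((θ * d : ℝ) * I) 3
    have hsum : ∑ m ∈ Finset.range 3, (((θ * d : ℝ) * I : ℂ)) ^ m / (m.factorial : ℂ) =
        1 + θ * d * I - θ ^ 2 * d ^ 2 / 2 := by
      simp only [Finset.sum_range_succ, Finset.sum_range_zero, Nat.factorial]
      push_cast
      linear_combination (θ ^ 2 * d ^ 2 / 2 : ℂ) * Complex.I_sq
    rw [hsum, ← hR] at h
    simp only [norm_mul, Complex.norm_I, mul_one, Complex.norm_real, Real.norm_eq_abs] at h
    rw [← abs_mul] at h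
    calc ‖R‖ ≤ |θ * d| ^ 3 * Real.exp |θ * d| := h
      _ ≤ (|θ| * D) ^ 3 * Real.exp D := by gcongr
      _ = _ := by ring
  have hθ2 : |θ| ^ 2 ≤ 1 := pow_le_one₀ (abs_nonneg _) hθ
  have heq : Complex.exp ((θ * d : ℝ) * I) * (1 + θ ^ 2 * w) -
      (1 + θ * d * I + θ ^ 2 * (w - d ^ 2 / 2)) =
      R * (1 + θ ^ 2 * w) + (θ ^ 3 * d * w * I - θ ^ 4 * d ^ 2 * w / 2) := by
    rw [hR]; ring
  have h1 : ‖(1 + θ ^ 2 * w : ℂ)‖ ≤ 1 + W := by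
    refine (norm_add_le _ _).trans ?_
    simp only [norm_one, norm_mul, norm_pow, Complex.norm_real, Real.norm_eq_abs]
    gcongr
    exact (mul_le_of_le_one_left (abs_nonneg _) hθ2).trans hw
  have h2 : ‖(θ ^ 3 * d * w * I - θ ^ 4 * d ^ 2 * w / 2 : ℂ)‖ ≤ |θ| ^ 3 * ((D + D ^ 2) * W) := by
    refine (norm_sub_le _ _).trans ?_
    simp only [norm_mul, norm_div, norm_pow, Complex.norm_real, Real.norm_eq_abs, Complex.norm_I,
      mul_one, Complex.norm_ofNat]
    have e1 : |θ| ^ 3 * |d| * |w| ≤ |θ| ^ 3 * D * W := by gcongr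
    have e2 : |θ| ^ 4 * |d| ^ 2 * |w| ≤ |θ| ^ 3 * D ^ 2 * W := by
      have : |θ| ^ 4 ≤ |θ| ^ 3 := pow_le_pow_of_le_one (abs_nonneg _) hθ (by norm_num)
      gcongr
    have e3 : 0 ≤ |θ| ^ 4 * |d| ^ 2 * |w| := by positivity
    linarith
  rw [heq]
  calc _ ≤ ‖R‖ * ‖(1 + θ ^ 2 * w : ℂ)‖ + ‖(θ ^ 3 * d * w * I - θ ^ 4 * d ^ 2 * w / 2 : ℂ)‖ :=
        (norm_add_le _ _).trans (by rw [norm_mul])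
    _ ≤ |θ| ^ 3 * (D ^ 3 * Real.exp D) * (1 + W) + |θ| ^ 3 * ((D + D ^ 2) * W) := by gcongr
    _ = _ := by ring

lemma norm_exp_mul_I (x : ℝ) : ‖Complex.exp ((x : ℂ) * I)‖ = 1 := Complex.norm_exp_ofReal_mul_I x

variable {L : ℕ} {p q : ℝ}

/-- One step of the chain multiplies the corrected exponential by `1 - θ² σ² / 2`, up to an error
of third order. -/
lemma exists_norm_sum_exp_corrIncr_le (hp : 0 < p) (hp1 : p < 1) (hq : 0 < q) (hq1 : q < 1)
    {Δ σ : ℝ} {g w : Hist L → ℝ}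
    (hg : ∀ η, ∑ s, stepProb p q η s * corrIncr Δ g η s = 0)
    (hw : ∀ η, ∑ s, stepProb p q η s * (w (Hist.push s η) - corrIncr Δ g η s ^ 2 / 2) =
      w η - σ / 2) :
    ∃ K : ℝ, 0 ≤ K ∧ ∀ θ : ℝ, |θ| ≤ 1 → ∀ η : Hist L,
      ‖∑ s, (stepProb p q η s : ℂ) * (Complex.exp ((θ * corrIncr Δ g η s : ℝ) * I) *
          (1 + θ ^ 2 * w (Hist.push s η))) -
        ((1 - θ ^ 2 * σ / 2) * (1 + θ ^ 2 * w η) : ℂ)‖ ≤ K * |θ| ^ 3 := by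
  obtain ⟨D, hD⟩ := Finite.bddAbove_range fun x : Hist L × ℤˣ ↦ |corrIncr Δ g x.1 x.2|
  obtain ⟨W, hW⟩ := Finite.bddAbove_range fun η : Hist L ↦ |w η|
  have hD' η s : |corrIncr Δ g η s| ≤ D := hD ⟨(η, s), rfl⟩
  have hW' η : |w η| ≤ W := hW ⟨η, rfl⟩
  have hD0 : 0 ≤ D := (abs_nonneg _).trans (hD' (fun _ ↦ 1) 1)
  have hW0 : 0 ≤ W := (abs_nonneg _).trans (hW' fun _ ↦ 1)
  set K₁ := D ^ 3 * Real.exp D * (1 + W) + (D + D ^ 2) * W with hK₁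
  refine ⟨K₁ + |σ| * W, by positivity, fun θ hθ η ↦ ?_⟩
  -- `hg` removes the term linear in `θ` and `hw` evaluates the quadratic one as `w η - σ / 2`;
  -- expanding the left-hand product leaves only the `θ ^ 4` term.
  have hmain : ((1 : ℂ) - θ ^ 2 * σ / 2) * (1 + θ ^ 2 * w η) =
      ∑ s, (stepProb p q η s : ℂ) * (1 + θ * corrIncr Δ g η s * I +
        θ ^ 2 * (w (Hist.push s η) - corrIncr Δ g η s ^ 2 / 2)) - θ ^ 4 * σ * w η / 2 := by
    have h1 := congrArg (fun x : ℝ ↦ (x : ℂ)) (hg η)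
    have h2 := congrArg (fun x : ℝ ↦ (x : ℂ)) (hw η)
    have h3 := congrArg (fun x : ℝ ↦ (x : ℂ)) (sum_stepProb (p := p) (q := q) η)
    simp only [sum_sign] at h1 h2 h3 ⊢
    push_cast at h1 h2 h3 ⊢
    linear_combination -h3 - θ * I * h1 - θ ^ 2 * h2
  rw [hmain, ← sub_add, ← Finset.sum_sub_distrib]
  simp only [← mul_sub]
  have hlast : ‖(θ ^ 4 * σ * w η / 2 : ℂ)‖ ≤ |σ| * W * |θ| ^ 3 := by
    simp only [norm_mul, norm_div, norm_pow, Complex.norm_real, Real.norm_eq_abs,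
      Complex.norm_ofNat]
    have : |θ| ^ 4 * |σ| * |w η| ≤ |θ| ^ 3 * |σ| * W := by
      have : |θ| ^ 4 ≤ |θ| ^ 3 := pow_le_pow_of_le_one (abs_nonneg _) hθ (by norm_num)
      have := hW' η
      gcongr
    have e3 : 0 ≤ |θ| ^ 4 * |σ| * |w η| := by positivity
    linarith
  refine (norm_add_le _ _).trans ?_
  rw [add_mul]
  refine add_le_add ((norm_sum_le _ _).trans ?_) hlast
  calc _ ≤ ∑ s, stepProb p q η s * (K₁ * |θ| ^ 3) := Finset.sum_le_sum fun s _ ↦ by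
        have hs := (stepProb_pos hp hp1 hq hq1 η s).le
        rw [norm_mul, Complex.norm_real, Real.norm_of_nonneg hs]
        exact mul_le_mul_of_nonneg_left
          (norm_exp_mul_one_add_sub_le hθ (hD' η s) (hW' _)) hs
    _ = _ := by rw [← Finset.sum_mul, sum_stepProb, one_mul]

end CharacteristicFunction

/-! ### From the one-step expansion to the central limit theorem. -/

section CentralLimit

open Complex (I)

variable {Ω : Type*} [MeasurableSpace Ω]

lemma measurable_comp_of_countable {ι β : Type*} [Countable ι] [MeasurableSpace β] {Z : Ω → ι}
    (hZ : ∀ i, MeasurableSet {ω | Z ω = i}) (F : ι → β) : Measurable fun ω ↦ F (Z ω) := by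
  let _ : MeasurableSpace ι := ⊤
  exact (measurable_from_top (f := F)).comp (measurable_to_countable' hZ)

variable {L : ℕ} {p q : ℝ} {μ : Measure Ω} {X : ℕ → Ω → ℤ} {Y : ℕ → Ω → Hist L}

/-- From time `N` on, the law of `(X, Y)` evolves according to the transition probabilities of the
chain of positions and histories. -/
structure EvolvesFrom (N : ℕ) (p q : ℝ) (μ : Measure Ω) (X : ℕ → Ω → ℤ) (Y : ℕ → Ω → Hist L) :
    Prop where
  measurable_pos : ∀ k, Measurable (X k)
  measurable_hist : ∀ k (η : Hist L), MeasurableSet {ω | Y k ω = η}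
  integral_step : ∀ k, N ≤ k → ∀ (Φ : ℤ → Hist L → ℂ) (B : ℝ), (∀ x η, ‖Φ x η‖ ≤ B) →
    ∫ ω, Φ (X (k + 1) ω) (Y (k + 1) ω) ∂μ =
      ∫ ω, ∑ s, (stepProb p q (Y k ω) s : ℂ) * Φ (X k ω + s) (Hist.push s (Y k ω)) ∂μ

namespace EvolvesFrom

variable {N : ℕ}

lemma measurable_comp (h : EvolvesFrom N p q μ X Y) {β : Type*} [MeasurableSpace β]
    (F : ℤ → Hist L → β) (k : ℕ) : Measurable fun ω ↦ F (X k ω) (Y k ω) := by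
  refine measurable_comp_of_countable (Z := fun ω ↦ (X k ω, Y k ω)) (fun i ↦ ?_)
    fun i ↦ F i.1 i.2
  have : {ω | (X k ω, Y k ω) = i} = X k ⁻¹' {i.1} ∩ {ω | Y k ω = i.2} := by
    ext ω; simp [Prod.ext_iff]
  rw [this]
  exact (h.measurable_pos k (measurableSet_singleton _)).inter (h.measurable_hist k _)

lemma integrable_comp [IsProbabilityMeasure μ] (h : EvolvesFrom N p q μ X Y)
    {F : ℤ → Hist L → ℂ} {B : ℝ} (hF : ∀ x η, ‖F x η‖ ≤ B) (k : ℕ) :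
    Integrable (fun ω ↦ F (X k ω) (Y k ω)) μ :=
  .of_bound (h.measurable_comp F k).aestronglyMeasurable B (ae_of_all _ fun _ ↦ hF _ _)

/-- The exponential of the compensated position, with a second-order correction. -/
noncomputable def corrExp (θ Δ : ℝ) (g w : Hist L → ℝ) (k : ℕ) (x : ℤ) (η : Hist L) : ℂ :=
  Complex.exp ((θ * (x - k * Δ + g η) : ℝ) * I) * (1 + θ ^ 2 * w η)

lemma norm_one_add_sq_mul_le {θ w W : ℝ} (hθ : |θ| ≤ 1) (hw : |w| ≤ W) :
    ‖(1 + θ ^ 2 * w : ℂ)‖ ≤ 1 + W := by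
  refine (norm_add_le _ _).trans ?_
  simp only [norm_one, norm_mul, norm_pow, Complex.norm_real, Real.norm_eq_abs]
  gcongr
  exact (mul_le_of_le_one_left (abs_nonneg _) (pow_le_one₀ (abs_nonneg _) hθ)).trans hw

lemma norm_corrExp_le {θ Δ W : ℝ} {g w : Hist L → ℝ} (hθ : |θ| ≤ 1) (hW : ∀ η, |w η| ≤ W)
    (k : ℕ) (x : ℤ) (η : Hist L) : ‖corrExp θ Δ g w k x η‖ ≤ 1 + W := by
  rw [corrExp, norm_mul, norm_exp_mul_I, one_mul]
  exact norm_one_add_sq_mul_le hθ (hW η)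

/-- The exponential of the current compensated position factors out of the step and has modulus one,
so the one-step error is uniform in the unbounded position. -/
lemma norm_integral_corrExp_succ_sub_le [IsProbabilityMeasure μ] (h : EvolvesFrom N p q μ X Y)
    {θ Δ σ K W : ℝ} {g w : Hist L → ℝ} (hθ : |θ| ≤ 1) (hW : ∀ η, |w η| ≤ W)
    (hK : ∀ η : Hist L,
      ‖∑ s, (stepProb p q η s : ℂ) * (Complex.exp ((θ * corrIncr Δ g η s : ℝ) * I) *
          (1 + θ ^ 2 * w (Hist.push s η))) -
        ((1 - θ ^ 2 * σ / 2) * (1 + θ ^ 2 * w η) : ℂ)‖ ≤ K) {k : ℕ} (hk : N ≤ k) :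
    ‖∫ ω, corrExp θ Δ g w (k + 1) (X (k + 1) ω) (Y (k + 1) ω) ∂μ -
      (1 - θ ^ 2 * σ / 2) * ∫ ω, corrExp θ Δ g w k (X k ω) (Y k ω) ∂μ‖ ≤ K := by
  rw [h.integral_step k hk _ _ (norm_corrExp_le hθ hW (k + 1))]
  have hfac (x : ℤ) (η : Hist L) :
      ∑ s, (stepProb p q η s : ℂ) * corrExp θ Δ g w (k + 1) (x + s) (Hist.push s η) =
        Complex.exp ((θ * (x - k * Δ + g η) : ℝ) * I) *
          ∑ s, (stepProb p q η s : ℂ) * (Complex.exp ((θ * corrIncr Δ g η s : ℝ) * I) *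
            (1 + θ ^ 2 * w (Hist.push s η))) := by
    rw [Finset.mul_sum]
    refine Finset.sum_congr rfl fun s _ ↦ ?_
    have : Complex.exp ((θ * ((x + s : ℤ) - (k + 1 : ℕ) * Δ + g (Hist.push s η)) : ℝ) * I) =
        Complex.exp ((θ * (x - k * Δ + g η) : ℝ) * I) *
          Complex.exp ((θ * corrIncr Δ g η s : ℝ) * I) := by
      rw [← Complex.exp_add, corrIncr]
      congr 1
      push_cast
      ring
    rw [corrExp, this]
    ring
  have hdiff (x : ℤ) (η : Hist L) :
      ‖∑ s, (stepProb p q η s : ℂ) * corrExp θ Δ g w (k + 1) (x + s) (Hist.push s η) -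
        (1 - θ ^ 2 * σ / 2) * corrExp θ Δ g w k x η‖ ≤ K := by
    rw [hfac, corrExp, mul_left_comm, ← mul_sub, norm_mul, norm_exp_mul_I, one_mul]
    exact hK η
  have hint1 : Integrable (fun ω ↦ (1 - θ ^ 2 * σ / 2 : ℂ) * corrExp θ Δ g w k (X k ω) (Y k ω)) μ :=
    (h.integrable_comp (norm_corrExp_le hθ hW k) k).const_mul _
  have hint2 : Integrable (fun ω ↦ ∑ s, (stepProb p q (Y k ω) s : ℂ) *
      corrExp θ Δ g w (k + 1) (X k ω + s) (Hist.push s (Y k ω))) μ := by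
    refine h.integrable_comp (F := fun x η ↦ ∑ s, (stepProb p q η s : ℂ) *
      corrExp θ Δ g w (k + 1) (x + s) (Hist.push s η))
      (B := K + ‖(1 - θ ^ 2 * σ / 2 : ℂ)‖ * (1 + W)) (fun x η ↦ ?_) k
    have h1 := norm_corrExp_le (Δ := Δ) (g := g) hθ hW k x η
    refine (norm_le_norm_sub_add _ ((1 - θ ^ 2 * σ / 2) * corrExp θ Δ g w k x η)).trans ?_
    rw [norm_mul]
    gcongr
    exact hdiff x η
  rw [← integral_const_mul, ← integral_sub hint2 hint1]
  refine (norm_integral_le_of_norm_le_const (ae_of_all _ fun ω ↦ hdiff _ _)).trans ?_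
  simp

/-- This disposes of the arbitrary law at the starting time: no moment is needed, only dominated
convergence at a fixed time. -/
lemma tendsto_integral_corrExp [IsProbabilityMeasure μ] (h : EvolvesFrom N p q μ X Y)
    {Δ W : ℝ} {g w : Hist L → ℝ} (hW : ∀ η, |w η| ≤ W) (k : ℕ) :
    Tendsto (fun θ ↦ ∫ ω, corrExp θ Δ g w k (X k ω) (Y k ω) ∂μ) (𝓝 0) (𝓝 1) := by
  have h1 : (1 : ℂ) = ∫ _ω, (1 : ℂ) ∂μ := by simp
  rw [h1]
  refine tendsto_integral_filter_of_dominated_convergence (fun _ ↦ 1 + W) ?_ ?_ ?_ ?_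
  · exact Eventually.of_forall fun θ ↦ (h.measurable_comp _ k).aestronglyMeasurable
  · have : ∀ᶠ θ : ℝ in 𝓝 0, |θ| ≤ 1 := by
      filter_upwards [Metric.closedBall_mem_nhds (0 : ℝ) one_pos] with θ hθ
      simpa using hθ
    filter_upwards [this] with θ hθ
    exact ae_of_all _ fun ω ↦ norm_corrExp_le hθ hW k _ _
  · exact integrable_const _
  · refine ae_of_all _ fun ω ↦ ?_
    have : Continuous fun θ : ℝ ↦ corrExp θ Δ g w k (X k ω) (Y k ω) := by
      unfold corrExp; fun_prop
    simpa [corrExp] using this.tendsto 0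

lemma norm_integral_corrExp_sub_le [IsProbabilityMeasure μ] (h : EvolvesFrom N p q μ X Y)
    {θ Δ G W : ℝ} {g w : Hist L → ℝ} (hθ : |θ| ≤ 1) (hG : ∀ η, |g η| ≤ G) (hW : ∀ η, |w η| ≤ W)
    (k : ℕ) :
    ‖∫ ω, Complex.exp ((θ * (X k ω - k * Δ) : ℝ) * I) ∂μ -
      ∫ ω, corrExp θ Δ g w k (X k ω) (Y k ω) ∂μ‖ ≤ |θ| * G + |θ| ^ 2 * W := by
  have hint1 : Integrable (fun ω ↦ Complex.exp ((θ * (X k ω - k * Δ) : ℝ) * I)) μ :=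
    h.integrable_comp (F := fun x _ ↦ Complex.exp ((θ * (x - k * Δ) : ℝ) * I))
      (fun x _ ↦ (norm_exp_mul_I _).le) k
  rw [← integral_sub hint1 (h.integrable_comp (norm_corrExp_le hθ hW k) k)]
  refine (norm_integral_le_of_norm_le_const (C := |θ| * G + |θ| ^ 2 * W)
    (ae_of_all _ fun ω ↦ ?_)).trans (by simp)
  generalize X k ω = x
  generalize Y k ω = η
  have hsplit : Complex.exp ((θ * (x - k * Δ + g η) : ℝ) * I) =
      Complex.exp ((θ * (x - k * Δ) : ℝ) * I) * Complex.exp (I * (θ * g η : ℝ)) := by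
    rw [← Complex.exp_add]; congr 1; push_cast; ring
  have heq : Complex.exp ((θ * (x - k * Δ) : ℝ) * I) - corrExp θ Δ g w k x η =
      -(Complex.exp ((θ * (x - k * Δ) : ℝ) * I) * (Complex.exp (I * (θ * g η : ℝ)) - 1)) -
        Complex.exp ((θ * (x - k * Δ + g η) : ℝ) * I) * (θ ^ 2 * w η) := by
    rw [corrExp, hsplit]; ring
  rw [heq]
  refine (norm_sub_le _ _).trans (add_le_add ?_ ?_)
  · rw [norm_neg, norm_mul, norm_exp_mul_I, one_mul]
    refine Real.norm_exp_I_mul_ofReal_sub_one_le.trans ?_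
    rw [Real.norm_eq_abs, abs_mul]
    exact mul_le_mul_of_nonneg_left (hG η) (abs_nonneg _)
  · rw [norm_mul, norm_exp_mul_I, one_mul]
    simp only [norm_mul, norm_pow, Complex.norm_real, Real.norm_eq_abs]
    exact mul_le_mul_of_nonneg_left (hW η) (by positivity)

/-- The central limit theorem from correctors: `g` solves the Poisson equation of the drift and
`w` that of the conditional variance. -/
theorem tendstoInDistribution [IsProbabilityMeasure μ] (h : EvolvesFrom N p q μ X Y)
    (hp : 0 < p) (hp1 : p < 1) (hq : 0 < q) (hq1 : q < 1) {Δ : ℝ} {σsq : NNReal}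
    {g w : Hist L → ℝ}
    (hg : ∀ η, ∑ s, stepProb p q η s * corrIncr Δ g η s = 0)
    (hw : ∀ η, ∑ s, stepProb p q η s * (w (Hist.push s η) - corrIncr Δ g η s ^ 2 / 2) =
      w η - σsq / 2) :
    TendstoInDistribution (fun (n : ℕ) ω ↦ ((X n ω : ℝ) - n * Δ) / √(n : ℝ))
      atTop id (fun _ ↦ μ) (gaussianReal 0 σsq) := by
  have hmeas (n : ℕ) : Measurable fun ω ↦ ((X n ω : ℝ) - n * Δ) / √(n : ℝ) :=
    h.measurable_comp (fun x _ ↦ ((x : ℝ) - n * Δ) / √(n : ℝ)) n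
  refine ⟨fun n ↦ (hmeas n).aemeasurable, aemeasurable_id, ?_⟩
  refine ProbabilityMeasure.tendsto_iff_tendsto_charFun.2 fun t ↦ ?_
  simp only [ProbabilityMeasure.coe_mk, Measure.map_id, charFun_gaussianReal]
  obtain ⟨K, hK0, hK⟩ := exists_norm_sum_exp_corrIncr_le hp hp1 hq hq1 hg hw
  obtain ⟨W, hW⟩ := Finite.bddAbove_range fun η : Hist L ↦ |w η|
  obtain ⟨G, hG⟩ := Finite.bddAbove_range fun η : Hist L ↦ |g η|
  have hW' η : |w η| ≤ W := hW ⟨η, rfl⟩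
  have hG' η : |g η| ≤ G := hG ⟨η, rfl⟩
  -- The one-step estimate holds from time `N` on, so `m` steps lead to time `m + N`, whose
  -- normalisation is used.
  set θ : ℕ → ℝ := fun m ↦ t / √((m + N : ℕ) : ℝ) with hθdef
  have hθ : Tendsto θ atTop (𝓝 0) :=
    tendsto_const_nhds.div_atTop
      (Real.tendsto_sqrt_atTop.comp (tendsto_natCast_atTop_atTop.comp (tendsto_add_atTop_nat N)))
  have hθsq {m : ℕ} (hm : m ≠ 0) : θ m ^ 2 = t ^ 2 / (m + N) := by
    rw [hθdef]; simp only [div_pow]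
    rw [Real.sq_sqrt (by positivity)]; push_cast; rfl
  set a : ℕ → ℝ → ℂ := fun k θ ↦ ∫ ω, corrExp θ Δ g w k (X k ω) (Y k ω) ∂μ with ha
  set lam : ℕ → ℂ := fun m ↦ 1 - (θ m : ℂ) ^ 2 * (σsq : ℝ) / 2 with hlam
  have hθ1 : ∀ᶠ m in atTop, |θ m| ≤ 1 := by
    filter_upwards [hθ.eventually (Metric.closedBall_mem_nhds (0 : ℝ) one_pos)] with m hm
    simpa using hm
  have hlam_real (m : ℕ) : lam m = ((1 - θ m ^ 2 * σsq / 2 : ℝ) : ℂ) := by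
    rw [hlam]; push_cast; rfl
  have hlam1 : ∀ᶠ m in atTop, ‖lam m‖ ≤ 1 := by
    have hlim : Tendsto (fun m ↦ θ m ^ 2 * σsq / 2) atTop (𝓝 0) := by
      simpa using ((hθ.pow 2).mul_const (σsq : ℝ)).div_const 2
    filter_upwards [hlim.eventually (gt_mem_nhds one_pos)] with m hm
    rw [hlam_real, Complex.norm_real, Real.norm_eq_abs, abs_le]
    have : 0 ≤ θ m ^ 2 * σsq / 2 := by positivity
    constructor <;> linarith
  have hlampow : Tendsto (fun m ↦ lam m ^ m) atTop (𝓝 (Complex.exp (-(σsq * t ^ 2 / 2) : ℝ))) := by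
    have hlim : Tendsto (fun m : ℕ ↦ (m : ℝ) * (-(θ m ^ 2 * σsq / 2))) atTop
        (𝓝 (-(σsq * t ^ 2 / 2))) := by
      have h1 : Tendsto (fun m : ℕ ↦ (m : ℝ) / (m + N)) atTop (𝓝 1) :=
        tendsto_natCast_div_add_atTop (N : ℝ)
      have h2 := h1.mul_const (-(σsq * t ^ 2 / 2))
      rw [one_mul] at h2
      refine h2.congr' ?_
      filter_upwards [eventually_ne_atTop 0] with m hm
      rw [hθsq hm]; ring
    have := (Complex.continuous_ofReal.tendsto _).comp
      (Real.tendsto_one_add_pow_exp_of_tendsto hlim)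
    rw [← Complex.ofReal_exp]
    refine this.congr fun m ↦ ?_
    rw [hlam_real, Function.comp_apply, ← Complex.ofReal_pow, sub_eq_add_neg]
  -- As `‖lam m‖ ≤ 1`, the one-step errors merely add up: `m * K * |θ m| ^ 3`, where `m * θ m ^ 2 ≤
  -- t ^ 2`.
  have hiter : ∀ᶠ m in atTop, ‖a (m + N) (θ m) - lam m ^ m * a N (θ m)‖ ≤ K * t ^ 2 * |θ m| := by
    filter_upwards [hθ1, hlam1, eventually_ne_atTop 0] with m h1 h2 hm
    have hind (j : ℕ) : ‖a (j + N) (θ m) - lam m ^ j * a N (θ m)‖ ≤ j * (K * |θ m| ^ 3) := by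
      induction j with
      | zero => simp
      | succ j ih =>
        have hstep := h.norm_integral_corrExp_succ_sub_le h1 hW' (hK (θ m) h1)
          (k := j + N) (by omega)
        have heq : a (j + 1 + N) (θ m) - lam m ^ (j + 1) * a N (θ m) =
            (a (j + N + 1) (θ m) - lam m * a (j + N) (θ m)) +
              lam m * (a (j + N) (θ m) - lam m ^ j * a N (θ m)) := by
          rw [show j + 1 + N = j + N + 1 by omega]; ring
        rw [heq]
        refine (norm_add_le _ _).trans ?_
        rw [norm_mul]
        have := mul_le_of_le_one_left (norm_nonneg (a (j + N) (θ m) - lam m ^ j * a N (θ m))) h2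
        push_cast
        linarith [hstep]
    refine (hind m).trans ?_
    have hmθ : m * |θ m| ^ 2 ≤ t ^ 2 := by
      have hm' : (0 : ℝ) < m := by exact_mod_cast Nat.pos_of_ne_zero hm
      rw [sq_abs, hθsq hm, mul_div_assoc', div_le_iff₀ (by positivity)]
      nlinarith [sq_nonneg t, (Nat.cast_nonneg N : (0 : ℝ) ≤ N)]
    calc (m : ℝ) * (K * |θ m| ^ 3) = K * (m * |θ m| ^ 2) * |θ m| := by ring
      _ ≤ _ := by gcongr
  have hlim1 : Tendsto (fun m ↦ a (m + N) (θ m)) atTop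
      (𝓝 (Complex.exp (-(σsq * t ^ 2 / 2) : ℝ))) := by
    have h1 : Tendsto (fun m ↦ a (m + N) (θ m) - lam m ^ m * a N (θ m)) atTop (𝓝 0) := by
      refine squeeze_zero_norm' hiter ?_
      simpa using hθ.abs.const_mul (K * t ^ 2)
    have h2 := hlampow.mul ((h.tendsto_integral_corrExp (Δ := Δ) (g := g) hW' N).comp hθ)
    have h3 := h1.add h2
    rw [zero_add, mul_one] at h3
    exact h3.congr fun m ↦ by simp [ha]
  have hlim2 : Tendsto (fun m ↦ ∫ ω, Complex.exp ((θ m * (X (m + N) ω - (m + N : ℕ) * Δ) : ℝ) * I)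
      ∂μ) atTop (𝓝 (Complex.exp (-(σsq * t ^ 2 / 2) : ℝ))) := by
    have h1 : Tendsto (fun m ↦
        ∫ ω, Complex.exp ((θ m * (X (m + N) ω - (m + N : ℕ) * Δ) : ℝ) * I) ∂μ - a (m + N) (θ m))
        atTop (𝓝 0) := by
      refine squeeze_zero_norm' (hθ1.mono fun m hm ↦
        h.norm_integral_corrExp_sub_le hm hG' hW' (m + N)) ?_
      simpa using (hθ.abs.mul_const G).add ((hθ.abs.pow 2).mul_const W)
    have h3 := h1.add hlim1
    rw [zero_add] at h3
    exact h3.congr fun m ↦ by ring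
  refine (tendsto_add_atTop_iff_nat N).1 ?_
  convert hlim2 using 2 with m
  · rw [charFun_apply_real, integral_map (hmeas _).aemeasurable (by fun_prop)]
    congr 1 with ω
    congr 2
    rw [hθdef]
    push_cast
    ring
  · push_cast
    congr 1
    ring

end EvolvesFrom

end CentralLimit

/-! ### Integration over the atoms of a countable past. -/

section Atoms

variable {Ω : Type*} [MeasurableSpace Ω] {μ : Measure Ω}

/-- If the future splits each atom `H = i` into two parts of conditional probabilities `c i 1` and
`c i (-1)`, then an integral may be computed by averaging over these two parts. -/
lemma integral_eq_integral_sum_sign [IsProbabilityMeasure μ] {ι : Type*} [Countable ι] {H : Ω → ι}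
    (hH : ∀ i, MeasurableSet {ω | H ω = i}) {A : ι → ℤˣ → Set Ω}
    (hAm : ∀ i s, MeasurableSet (A i s)) (hA : ∀ i s, A i s ⊆ {ω | H ω = i})
    (hdisj : ∀ i, Disjoint (A i 1) (A i (-1))) {c : ι → ℤˣ → ℝ} (hc : ∀ i, ∑ s, c i s = 1)
    (hμ : ∀ i s, μ.real (A i s) = c i s * μ.real {ω | H ω = i}) {Φ Ψ : Ω → ℂ}
    (hΦint : Integrable Φ μ) (hΨint : Integrable Ψ μ) {φ : ι → ℤˣ → ℂ}
    (hΦ : ∀ i s, ∀ ω ∈ A i s, Φ ω = φ i s)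
    (hΨ : ∀ ω, Ψ ω = ∑ s, (c (H ω) s : ℂ) * φ (H ω) s) :
    ∫ ω, Φ ω ∂μ = ∫ ω, Ψ ω ∂μ := by
  have hU : (⋃ i, {ω | H ω = i}) = Set.univ := by ext ω; simp
  have hd : Pairwise (Function.onFun Disjoint fun i ↦ {ω | H ω = i}) := fun i j hij ↦
    Set.disjoint_left.2 fun ω (h1 : H ω = i) (h2 : H ω = j) ↦ hij (h1.symm.trans h2)
  have hsplit (F : Ω → ℂ) (hF : Integrable F μ) :
      ∫ ω, F ω ∂μ = ∑' i, ∫ ω in {ω | H ω = i}, F ω ∂μ := by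
    rw [← integral_iUnion hH hd hF.integrableOn, hU, setIntegral_univ]
  rw [hsplit Φ hΦint, hsplit Ψ hΨint]
  congr 1 with i
  have hΨi : ∫ ω in {ω | H ω = i}, Ψ ω ∂μ =
      (μ.real {ω | H ω = i} : ℂ) * ∑ s, (c i s : ℂ) * φ i s := by
    rw [setIntegral_congr_fun (hH i) (g := fun _ ↦ ∑ s, (c i s : ℂ) * φ i s)
      (fun ω (hω : H ω = i) ↦ by simp only [hΨ, hω])]
    rw [setIntegral_const, Complex.real_smul]
  -- The two parts carry the whole mass of the atom, so they exhaust it up to a null set; what `Φ`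
  -- does elsewhere is irrelevant.
  have hunion : μ.real (A i 1 ∪ A i (-1)) = μ.real {ω | H ω = i} := by
    rw [measureReal_union (hdisj i) (hAm i _), hμ, hμ, ← add_mul, ← sum_sign (c i), hc, one_mul]
  have hsub : A i 1 ∪ A i (-1) ⊆ {ω | H ω = i} := Set.union_subset (hA i 1) (hA i (-1))
  have hae : (A i 1 ∪ A i (-1) : Set Ω) =ᵐ[μ] {ω | H ω = i} := by
    refine ae_eq_of_subset_of_measure_ge hsub ?_
      ((hAm i 1).union (hAm i (-1))).nullMeasurableSet (measure_ne_top _ _)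
    exact ((measureReal_eq_measureReal_iff (measure_ne_top _ _) (measure_ne_top _ _)).1
      hunion).ge
  have hpart (s : ℤˣ) : ∫ ω in A i s, Φ ω ∂μ = (μ.real (A i s) : ℂ) * φ i s := by
    rw [setIntegral_congr_fun (hAm i s) (g := fun _ ↦ φ i s) (hΦ i s)]
    simp
  rw [hΨi, ← setIntegral_congr_set hae, setIntegral_union (hdisj i) (hAm i _)
    hΦint.integrableOn hΦint.integrableOn, hpart, hpart, hμ, hμ, sum_sign]
  push_cast
  ring

/-- The path that follows `h` up to time `k`. -/
def extendPath {α : Type*} {k : ℕ} (h : Fin (k + 1) → α) (i : ℕ) : α := h (Fin.ofNat (k + 1) i)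

lemma restrict_eq_iff {α : Type*} {k : ℕ} {z : ℕ → α} {h : Fin (k + 1) → α} :
    (fun i : Fin (k + 1) ↦ z i) = h ↔ ∀ i ≤ k, z i = extendPath h i := by
  constructor
  · rintro rfl i hi
    simp [extendPath, Nat.mod_eq_of_lt (Nat.lt_succ_of_le hi)]
  · intro H
    ext i
    rw [H i (Nat.le_of_lt_succ i.2), extendPath]
    congr 1
    ext
    simp

end Atoms

/-! ### The chain and the walk both evolve by the transition probabilities. -/

section Chain

variable {Ω : Type*} [MeasurableSpace Ω] {μ : Measure Ω}
  {L : ℕ} {p q : ℝ} {X : ℕ → Ω → ℤ}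

lemma add_one_ne_add_neg_one (x : ℤ) : x + ((1 : ℤˣ) : ℤ) ≠ x + ((-1 : ℤˣ) : ℤ) := by
  simp only [Units.val_one, Units.val_neg]; omega

lemma norm_sum_stepProb_mul_le (hp : 0 < p) (hp1 : p < 1) (hq : 0 < q) (hq1 : q < 1)
    (η : Hist L) {φ : ℤˣ → ℂ} {B : ℝ} (hφ : ∀ s, ‖φ s‖ ≤ B) :
    ‖∑ s, (stepProb p q η s : ℂ) * φ s‖ ≤ B := by
  refine (norm_sum_le _ _).trans ?_
  calc _ ≤ ∑ s, stepProb p q η s * B := Finset.sum_le_sum fun s _ ↦ by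
        have hs := (stepProb_pos hp hp1 hq hq1 η s).le
        rw [norm_mul, Complex.norm_real, Real.norm_of_nonneg hs]
        exact mul_le_mul_of_nonneg_left (hφ s) hs
    _ = B := by rw [← Finset.sum_mul, sum_stepProb, one_mul]

theorem IsFiniteMemoryChain.evolvesFrom [IsProbabilityMeasure μ] {Y : ℕ → Ω → Hist L}
    (hp : 0 < p) (hp1 : p < 1) (hq : 0 < q) (hq1 : q < 1)
    (h : IsFiniteMemoryChain L p q μ X Y) : EvolvesFrom 0 p q μ X Y := by
  have hXm (k : ℕ) (x : ℤ) : MeasurableSet {ω | X k ω = x} :=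
    h.measurable_pos k (measurableSet_singleton x)
  have hZm (k : ℕ) (z : ℤ × Hist L) : MeasurableSet {ω | (X k ω, Y k ω) = z} := by
    have : {ω | (X k ω, Y k ω) = z} = {ω | X k ω = z.1} ∩ {ω | Y k ω = z.2} := by
      ext ω; simp [Prod.ext_iff]
    rw [this]
    exact (hXm k _).inter (h.measurable_hist k _)
  have hmeas {β : Type} [MeasurableSpace β] (F : ℤ → Hist L → β) (k : ℕ) :
      Measurable fun ω ↦ F (X k ω) (Y k ω) :=
    measurable_comp_of_countable (hZm k) fun z ↦ F z.1 z.2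
  refine ⟨h.measurable_pos, h.measurable_hist, fun k _ Φ B hB ↦ ?_⟩
  set H : Ω → Fin (k + 1) → ℤ × Hist L := fun ω i ↦ (X i ω, Y i ω) with hHdef
  have hHeq (z : Fin (k + 1) → ℤ × Hist L) : {ω | H ω = z} =
      {ω | ∀ i ≤ k, X i ω = (extendPath z i).1 ∧ Y i ω = (extendPath z i).2} := by
    ext ω
    have := restrict_eq_iff (z := fun i ↦ (X i ω, Y i ω)) (h := z)
    simp only [Prod.ext_iff] at this
    exact this
  have hHm (z : Fin (k + 1) → ℤ × Hist L) : MeasurableSet {ω | H ω = z} := by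
    have : {ω | H ω = z} = ⋂ i : Fin (k + 1), {ω | (X i ω, Y i ω) = z i} := by
      ext ω; simp [hHdef, funext_iff]
    rw [this]
    exact MeasurableSet.iInter fun i ↦ hZm i (z i)
  have hlast (ω : Ω) : extendPath (H ω) k = (X k ω, Y k ω) :=
    ((restrict_eq_iff (z := fun i ↦ (X i ω, Y i ω)) (h := H ω)).1 rfl k le_rfl).symm
  refine integral_eq_integral_sum_sign hHm
    (A := fun z s ↦ {ω | (∀ i ≤ k, X i ω = (extendPath z i).1 ∧ Y i ω = (extendPath z i).2) ∧
      X (k + 1) ω = (extendPath z k).1 + (s : ℤ) ∧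
      Y (k + 1) ω = Hist.push s (extendPath z k).2})
    (c := fun z s ↦ stepProb p q (extendPath z k).2 s)
    (φ := fun z s ↦ Φ ((extendPath z k).1 + s) (Hist.push s (extendPath z k).2))
    (fun z s ↦ ?_) (fun z s ω hω ↦ ?_) (fun z ↦ ?_) (fun z ↦ sum_stepProb _) (fun z s ↦ ?_)
    ?_ ?_ (fun z s ω hω ↦ ?_) (fun ω ↦ ?_)
  · have hs : MeasurableSet ({ω | H ω = z} ∩ ({ω | X (k + 1) ω = (extendPath z k).1 + (s : ℤ)} ∩
        {ω | Y (k + 1) ω = Hist.push s (extendPath z k).2})) :=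
      (hHm z).inter ((hXm _ _).inter (h.measurable_hist _ _))
    rw [hHeq] at hs
    exact hs
  · rw [hHeq]; exact hω.1
  · exact Set.disjoint_left.2 fun ω h1 h2 ↦
      add_one_ne_add_neg_one _ (h1.2.1.symm.trans h2.2.1)
  · rw [hHeq]
    exact h.step k (fun i ↦ (extendPath z i).1) (fun i ↦ (extendPath z i).2) s
  · exact .of_bound (hmeas Φ (k + 1)).aestronglyMeasurable B (ae_of_all _ fun _ ↦ hB _ _)
  · exact .of_bound (hmeas (fun x η ↦ ∑ s, (stepProb p q η s : ℂ) * Φ (x + s) (Hist.push s η))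
      k).aestronglyMeasurable B
      (ae_of_all _ fun _ ↦ norm_sum_stepProb_mul_le hp hp1 hq hq1 _ fun _ ↦ hB _ _)
  · rw [hω.2.1, hω.2.2]
  · simp only [hlast]

/-- The history at time `k` of the path `x`. -/
def pathHist (L : ℕ) (x : ℕ → ℤ) (k : ℕ) : Hist L := fun i ↦
  -- For `k < L` truncated subtraction makes the missing steps `x 0 - x 0 = 0`, recorded as `-1`.
  -- The step probabilities are compared only for `L ≤ k`.
  if x (k - i) - x (k - i - 1) = 1 then 1 else -1

lemma pathHist_congr {x x' : ℕ → ℤ} {k : ℕ} (h : ∀ i ≤ k, x i = x' i) :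
    pathHist L x k = pathHist L x' k := by
  ext i
  rw [pathHist, pathHist, h _ (by omega), h _ (by omega)]

lemma pathHist_succ {x : ℕ → ℤ} {k : ℕ} {s : ℤˣ} (h : x (k + 1) = x k + s) :
    pathHist L x (k + 1) = Hist.push s (pathHist L x k) := by
  funext i
  unfold Hist.push pathHist
  by_cases h0 : (i : ℕ) = 0
  · simp only [h0, if_true, Nat.sub_zero, Nat.add_sub_cancel, h, add_sub_cancel_left]
    rcases Int.units_eq_one_or s with rfl | rfl <;> simp
  · simp only [h0, if_false]
    rw [show k - (i - 1 : ℕ) = k + 1 - i by omega]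

/-- The path `x` makes unit steps up to time `k`. -/
def UnitSteps (x : ℕ → ℤ) (k : ℕ) : Prop := ∀ j < k, x (j + 1) = x j + 1 ∨ x (j + 1) = x j - 1

/-- Telescoping; this is what translates sign conditions on partial sums of the history into
comparisons of `x k` with the earlier positions. -/
lemma UnitSteps.sum_pathHist {x : ℕ → ℤ} {k : ℕ} (hx : UnitSteps x k) (hk : L ≤ k) (j : Fin L) :
    ∑ i ∈ Finset.Iic j, (pathHist L x k i : ℤ) = x k - x (k - (j + 1)) := by
  have hstep (i : Fin L) : (pathHist L x k i : ℤ) = x (k - i) - x (k - i - 1) := by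
    have h1 := hx (k - i - 1) (by omega)
    rw [show k - (i : ℕ) - 1 + 1 = k - i by omega] at h1
    unfold pathHist
    split_ifs with h2
    · simp [h2]
    · simp only [Units.val_neg, Units.val_one]; omega
  obtain ⟨n, hn⟩ := j
  induction n with
  | zero =>
    have : Finset.Iic (⟨0, hn⟩ : Fin L) = {⟨0, hn⟩} := by
      ext i; simp [Fin.le_def, Fin.ext_iff]
    rw [this, Finset.sum_singleton, hstep]
    simp
  | succ n ih =>
    have : Finset.Iic (⟨n + 1, hn⟩ : Fin L) = insert ⟨n + 1, hn⟩ (Finset.Iic ⟨n, by omega⟩) := by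
      ext i; simp only [Finset.mem_Iic, Finset.mem_insert, Fin.le_def, Fin.ext_iff]; omega
    rw [this, Finset.sum_insert (by simp [Fin.le_def]), ih, hstep]
    simp only
    rw [show k - (n + 1) - 1 = k - (n + 1 + 1) by omega]
    ring

lemma UnitSteps.locMax_iff {x : ℕ → ℤ} {k : ℕ} (hx : UnitSteps x k) (hk : L ≤ k) :
    (pathHist L x k).LocMax ↔ AtMax L x k := by
  simp only [Hist.LocMax, AtMax, hx.sum_pathHist hk, sub_nonneg, min_eq_left hk]
  refine ⟨fun h m hm ↦ ?_, fun h j ↦ h _ j.2⟩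
  rcases m with _ | m
  · simp
  · exact h ⟨m, hm⟩

lemma UnitSteps.locMin_iff {x : ℕ → ℤ} {k : ℕ} (hx : UnitSteps x k) (hk : L ≤ k) :
    (pathHist L x k).LocMin ↔ AtMin L x k := by
  simp only [Hist.LocMin, AtMin, hx.sum_pathHist hk, sub_nonpos, min_eq_left hk]
  refine ⟨fun h m hm ↦ ?_, fun h j ↦ h _ j.2⟩
  rcases m with _ | m
  · simp
  · exact h ⟨m, hm⟩

lemma UnitSteps.walkUp_eq [NeZero L] {x : ℕ → ℤ} {k : ℕ} (hx : UnitSteps x k) (hk : L ≤ k) :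
    walkUp L p q x k = histUp p q (pathHist L x k) := by
  unfold walkUp histUp
  rw [← hx.locMax_iff hk, ← hx.locMin_iff hk]
  have h := Hist.not_locMin_of_locMax (η := pathHist L x k)
  by_cases hM : (pathHist L x k).LocMax
  · simp [hM, h hM]
  · simp [hM]

namespace IsFiniteMemoryWalk

lemma measurableSet_atom (h : IsFiniteMemoryWalk L p q μ X) (k : ℕ) (x : ℕ → ℤ) :
    MeasurableSet {ω | ∀ i ≤ k, X i ω = x i} := by
  have : {ω | ∀ i ≤ k, X i ω = x i} = ⋂ i, ⋂ (_ : i ≤ k), {ω | X i ω = x i} := by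
    ext ω; simp
  rw [this]
  exact MeasurableSet.iInter fun i ↦ MeasurableSet.iInter fun _ ↦
    h.measurable i (measurableSet_singleton (x i))

/-- The up and down probabilities add to one, so these two steps already use the full mass of the
atom up to time `j`; a path with another step at `j` lies in the null remainder. -/
lemma measureReal_atom_eq_zero [IsProbabilityMeasure μ] (h : IsFiniteMemoryWalk L p q μ X) {k : ℕ} {x : ℕ → ℤ}
    (hx : ¬ UnitSteps x k) : μ.real {ω | ∀ i ≤ k, X i ω = x i} = 0 := by
  simp only [UnitSteps, not_forall, not_or] at hx
  obtain ⟨j, hj, h1, h2⟩ := hx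
  have hm (y : ℤ) : MeasurableSet {ω | (∀ i ≤ j, X i ω = x i) ∧ X (j + 1) ω = y} :=
    (h.measurableSet_atom j x).inter (h.measurable (j + 1) (measurableSet_singleton y))
  have hdisj : Disjoint {ω | (∀ i ≤ j, X i ω = x i) ∧ X (j + 1) ω = x j + 1}
      {ω | (∀ i ≤ j, X i ω = x i) ∧ X (j + 1) ω = x j - 1} :=
    Set.disjoint_left.2 fun ω (a : _ ∧ _) (b : _ ∧ _) ↦ by
      have := a.2.symm.trans b.2; omega
  have hdisj' : Disjoint {ω | ∀ i ≤ k, X i ω = x i}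
      ({ω | (∀ i ≤ j, X i ω = x i) ∧ X (j + 1) ω = x j + 1} ∪
        {ω | (∀ i ≤ j, X i ω = x i) ∧ X (j + 1) ω = x j - 1}) := by
    refine Set.disjoint_left.2 fun ω (a : ∀ i ≤ k, X i ω = x i) b ↦ ?_
    have a' := a (j + 1) hj
    rcases b with b | b
    · exact h1 (a'.symm.trans b.2)
    · exact h2 (a'.symm.trans b.2)
  have hsub : {ω | ∀ i ≤ k, X i ω = x i} ∪
      ({ω | (∀ i ≤ j, X i ω = x i) ∧ X (j + 1) ω = x j + 1} ∪
        {ω | (∀ i ≤ j, X i ω = x i) ∧ X (j + 1) ω = x j - 1}) ⊆ {ω | ∀ i ≤ j, X i ω = x i} := by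
    rintro ω (a | a | a)
    · exact fun i hi ↦ a i (by omega)
    · exact a.1
    · exact a.1
  have hle := measureReal_mono (μ := μ) hsub
  rw [measureReal_union hdisj' ((hm _).union (hm _)), measureReal_union hdisj (hm _),
    h.up, h.down] at hle
  have := measureReal_nonneg (μ := μ) (s := {ω | ∀ i ≤ k, X i ω = x i})
  linarith

lemma measureReal_step [NeZero L] [IsProbabilityMeasure μ] (h : IsFiniteMemoryWalk L p q μ X) {k : ℕ} (hk : L ≤ k)
    (x : ℕ → ℤ) (s : ℤˣ) :
    μ.real {ω | (∀ i ≤ k, X i ω = x i) ∧ X (k + 1) ω = x k + (s : ℤ)} =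
      stepProb p q (pathHist L x k) s * μ.real {ω | ∀ i ≤ k, X i ω = x i} := by
  by_cases hx : UnitSteps x k
  · rcases Int.units_eq_one_or s with rfl | rfl
    · rw [stepProb_one, ← hx.walkUp_eq hk]
      exact h.up k x
    · rw [stepProb_neg_one, ← hx.walkUp_eq hk]
      exact h.down k x
  · have h0 := h.measureReal_atom_eq_zero hx
    rw [h0, mul_zero]
    refine le_antisymm ?_ measureReal_nonneg
    rw [← h0]
    exact measureReal_mono fun ω hω ↦ hω.1

/-- Time `L` is where the memory window first has its full length, so that `walkUp` is a function of
the history. Paths with non-unit steps, where the two may disagree, have null atoms. -/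
theorem evolvesFrom [NeZero L] [IsProbabilityMeasure μ] (hp : 0 < p) (hp1 : p < 1) (hq : 0 < q) (hq1 : q < 1)
    (h : IsFiniteMemoryWalk L p q μ X) :
    EvolvesFrom L p q μ X fun k ω ↦ pathHist L (fun i ↦ X i ω) k := by
  have hHeq (k : ℕ) (z : Fin (k + 1) → ℤ) : {ω | (fun i : Fin (k + 1) ↦ X i ω) = z} =
      {ω | ∀ i ≤ k, X i ω = extendPath z i} := by
    ext ω
    exact restrict_eq_iff (z := fun i ↦ X i ω)
  have hHm (k : ℕ) (z : Fin (k + 1) → ℤ) :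
      MeasurableSet {ω | (fun i : Fin (k + 1) ↦ X i ω) = z} := by
    rw [hHeq]
    exact h.measurableSet_atom k _
  have hpath (k : ℕ) (ω : Ω) : ∀ i ≤ k, X i ω = extendPath (fun i : Fin (k + 1) ↦ X i ω) i :=
    (restrict_eq_iff (z := fun i ↦ X i ω)).1 rfl
  have hhist (k : ℕ) (ω : Ω) : pathHist L (fun i ↦ X i ω) k =
      pathHist L (extendPath fun i : Fin (k + 1) ↦ X i ω) k := pathHist_congr (hpath k ω)
  have hmeas {β : Type} [MeasurableSpace β] (F : ℤ → Hist L → β) (k : ℕ) :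
      Measurable fun ω ↦ F (X k ω) (pathHist L (fun i ↦ X i ω) k) := by
    have := measurable_comp_of_countable (hHm k)
      fun z ↦ F (extendPath z k) (pathHist L (extendPath z) k)
    refine (congrArg Measurable (funext fun ω ↦ ?_)).mp this
    rw [hhist, hpath k ω k le_rfl]
  refine ⟨h.measurable, fun k η ↦ ?_, fun k hk Φ B hB ↦ ?_⟩
  · exact measurableSet_setOfPred.2 (hmeas (fun _ η' ↦ η' = η) k)
  refine integral_eq_integral_sum_sign (hHm k)
    (A := fun z s ↦ {ω | (∀ i ≤ k, X i ω = extendPath z i) ∧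
      X (k + 1) ω = extendPath z k + (s : ℤ)})
    (c := fun z s ↦ stepProb p q (pathHist L (extendPath z) k) s)
    (φ := fun z s ↦ Φ (extendPath z k + s) (Hist.push s (pathHist L (extendPath z) k)))
    (fun z s ↦ ?_) (fun z s ω hω ↦ ?_) (fun z ↦ ?_) (fun z ↦ sum_stepProb _) (fun z s ↦ ?_)
    ?_ ?_ (fun z s ω hω ↦ ?_) (fun ω ↦ ?_)
  · exact (h.measurableSet_atom k _).inter (h.measurable (k + 1) (measurableSet_singleton _))
  · exact (restrict_eq_iff (z := fun i ↦ X i ω)).2 hω.1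
  · exact Set.disjoint_left.2 fun ω h1 h2 ↦ add_one_ne_add_neg_one _ (h1.2.symm.trans h2.2)
  · rw [hHeq]
    exact h.measureReal_step hk _ s
  · exact .of_bound (hmeas Φ (k + 1)).aestronglyMeasurable B (ae_of_all _ fun _ ↦ hB _ _)
  · exact .of_bound (hmeas (fun x η ↦ ∑ s, (stepProb p q η s : ℂ) * Φ (x + s) (Hist.push s η))
      k).aestronglyMeasurable B
      (ae_of_all _ fun _ ↦ norm_sum_stepProb_mul_le hp hp1 hq hq1 _ fun _ ↦ hB _ _)
  · have h1 : X (k + 1) ω = X k ω + s := by rw [hω.2, hω.1 k le_rfl]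
    rw [pathHist_succ (x := fun i ↦ X i ω) h1, hω.2, pathHist_congr hω.1]
  · rw [hhist, hpath k ω k le_rfl]

end IsFiniteMemoryWalk

end Chain

end Snake

theorem theorem3 (L : ℕ) [NeZero L] (p q : ℝ) (hp : 0 < p) (hp1 : p < 1) (hq : 0 < q)
    (hq1 : q < 1) :
    ∃ π : Snake.Hist L → ℝ,
      Snake.IsStationary L p q π ∧
      (∀ π' : Snake.Hist L → ℝ, Snake.IsStationary L p q π' → π' = π) ∧
      ∃ (c : ℝ) (σsq : NNReal),
        Tendsto (fun m : ℕ => ∑ k ∈ Finset.Icc 1 (m + 1), Snake.autocov L p q π k)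
          atTop (𝓝 c) ∧
        (σsq : ℝ) = Snake.varStep π + 2 * c ∧
        (∀ (Ω : Type*) [MeasurableSpace Ω] (μ : Measure Ω) [IsProbabilityMeasure μ]
          (X : ℕ → Ω → ℤ), Snake.IsFiniteMemoryWalk L p q μ X →
          TendstoInDistribution
            (fun (n : ℕ) ω => ((X n ω : ℝ) - n * Snake.speed L p q π) / √(n : ℝ))
            atTop id (fun _ => μ) (gaussianReal 0 σsq)) ∧
        (∀ (Ω : Type*) [MeasurableSpace Ω] (μ : Measure Ω) [IsProbabilityMeasure μ]
          (X : ℕ → Ω → ℤ) (Y : ℕ → Ω → Snake.Hist L),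
          Snake.IsFiniteMemoryChain L p q μ X Y →
          TendstoInDistribution
            (fun (n : ℕ) ω => ((X n ω : ℝ) - n * Snake.speed L p q π) / √(n : ℝ))
            atTop id (fun _ => μ) (gaussianReal 0 σsq)) := by
  obtain ⟨π, hπ, huniq, c, σsq, hc, hσ, g, w, hg, hw⟩ :=
    Snake.exists_stationary_and_correctors (L := L) hp hp1 hq hq1
  exact ⟨π, hπ, huniq, c, σsq, hc, hσ,
    fun Ω _ μ _ X h ↦
      (h.evolvesFrom hp hp1 hq hq1).tendstoInDistribution hp hp1 hq hq1 hg hw,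
    fun Ω _ μ _ X Y h ↦
      (h.evolvesFrom hp hp1 hq hq1).tendstoInDistribution hp hp1 hq hq1 hg hw⟩
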